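/- For $\theta\in\mathbb R$ let $\mathbb C_\theta=\{s\in\mathbb C:\operatorname{Re}s>\theta\}$. Let $\mathcal A^+$ be the Banach space of functions $f(s)=\sum_{n\ge1}a_nn^{-s}$ on $\mathbb C_0$ with $\|f\|_{\mathcal A^+}=\sum_{n\ge1}|a_n|<\infty$, and let $\mathcal D$ be the space of analytic functions on $\mathbb C_0$ that are representable by a convergent Dirichlet series $\sum_{n\ge1}c_nn^{-s}$ for $\operatorname{Re}s$ large enough. Let $\phi:\mathbb C_0\to\mathbb C$ be a non-constant function of the form $\phi(s)=c_0s+\varphi(s)$ with $c_0\in\mathbb N_0=\{0,1,2,\dots\}$ and $\varphi\in\mathcal D$, and let $C_\phi f=f\circ\phi$; for $f=\sum a_nn^{-s}\in\mathcal A^+$, $f\circ\phi$ is said to be defined if $\sum a_nn^{-\phi(s)}$ converges absolutely for every $s\in\mathbb C_0$, and then $(f\circ\phi)(s)$ is its sum. That $C_\phi$ maps $\mathcal A^+$ into itself means that $f\circ\phi$ is defined and lies in $\mathcal A^+$ for every $f\in\mathcal A^+$. Then: (a) (i) If $C_\phi$ maps $\mathcal A^+$ into itself, then $n^{-\phi}\in\mathcal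 A^+$ for all $n\ge1$ and there is a constant $C$ with $\|n^{-\phi}\|_{\mathcal A^+}\le C$ for all $n\ge1$. (ii) Conversely, if $n^{-\phi}\in\mathcal A^+$ for all $n\ge1$ and $\sup_{n\ge 1}\|n^{-\phi}\|_{\mathcal A^+}<\infty$, then $\phi(\mathbb C_0)\subseteq\mathbb C_0$ and $C_\phi$ is a bounded operator from $\mathcal A^+$ to $\mathcal A^+$. (b) (i) $C_\phi$ is a compact operator from $\mathcal A^+$ to $\mathcal A^+$ if and only if $n^{-\phi}\in\mathcal A^+$ for all $n\ge1$ and $\|n^{-\phi}\|_{\mathcal A^+}\to0$ as $n\to\infty$. In that case $\phi(\mathbb C_0)\subseteq\mathbb C_\delta$ for some $\delta>0$. (ii) Suppose that the coefficients $c_n$ of $\varphi$ (where $\varphi(s)=\sum_{n\ge1}c_nn^{-s}$ for $\operatorname{Re}s$ large) satisfy $\sum_{n\ge1}|c_n|<\infty$. Then $C_\phi$ is compact if and only if $\phi(\mathbb C_0)\subseteq\mathbb C_\delta$ for some $\delta>0$. -/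

import Mathlib

open Filter Topology Set

noncomputable section

namespace WienerDirichlet

/-- The open vertical half-plane `Re s > θ`. -/
def halfPlane (θ : ℝ) : Set ℂ := {s | θ < s.re}

/-- The Wiener-Dirichlet algebra `𝒜⁺` as a Banach space: an element is a Dirichlet series
`∑_{n ≥ 1} a_n n^{-s}` given by its coefficients, with norm `∑ |a_n| < ∞`. -/
abbrev WD : Type := lp (fun _ : ℕ+ => ℂ) 1

/-- The function on `Re s > 0` defined by an element of `𝒜⁺`: `f(s) = ∑ a_n n^{-s}`. -/
def WD.eval (f : WD) (s : ℂ) : ℂ := ∑' n : ℕ+, f n * ((n : ℕ) : ℂ) ^ (-s)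

/-- The function `F`, considered on `Re s > 0`, is (the function defined by) the element `f`
of `𝒜⁺`. -/
def Represents (f : WD) (F : ℂ → ℂ) : Prop := EqOn f.eval F (halfPlane 0)

/-- `ϕ(s) = ∑ c_n n^{-s}`, as a convergent (not necessarily absolutely convergent) series, for
all `s` of sufficiently large real part. -/
def HasDirichletExpansion (ϕ : ℂ → ℂ) (c : ℕ+ → ℂ) : Prop :=
  ∃ σ : ℝ, ∀ s : ℂ, σ < s.re →
    Tendsto (fun N : ℕ+ => ∑ n ∈ Finset.Icc 1 N, c n * ((n : ℕ) : ℂ) ^ (-s)) atTop (𝓝 (ϕ s))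

/-- The space `𝒟` of convergent Dirichlet series: functions analytic on `Re s > 0` which are
representable as a convergent Dirichlet series for `Re s` large enough. -/
def IsConvergentDirichletSeries (ϕ : ℂ → ℂ) : Prop :=
  DifferentiableOn ℂ ϕ (halfPlane 0) ∧ ∃ c : ℕ+ → ℂ, HasDirichletExpansion ϕ c

/-- `g = f ∘ φ` on `Re s > 0`: at each such `s` the Dirichlet series of `f` converges absolutely
at `φ s`, with sum `g(s)`. (This makes sense before `φ` is known to map `Re s > 0` into itself.) -/
def IsComp (φ : ℂ → ℂ) (f g : WD) : Prop :=
  ∀ s ∈ halfPlane 0, HasSum (fun n : ℕ+ => f n * ((n : ℕ) : ℂ) ^ (-φ s)) (g.eval s)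

/-- `C_φ` maps `𝒜⁺` into itself. -/
def CompMapsInto (φ : ℂ → ℂ) : Prop := ∀ f : WD, ∃ g : WD, IsComp φ f g

/-- `C_φ` is a bounded operator `𝒜⁺ → 𝒜⁺`. -/
def CompBounded (φ : ℂ → ℂ) : Prop := ∃ T : WD →L[ℂ] WD, ∀ f : WD, IsComp φ f (T f)

/-- `C_φ` is a compact operator `𝒜⁺ → 𝒜⁺`. -/
def CompCompact (φ : ℂ → ℂ) : Prop :=
  ∃ T : WD →L[ℂ] WD, (∀ f : WD, IsComp φ f (T f)) ∧ IsCompactOperator T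

/-- Every `n^{-φ}` lies in `𝒜⁺`, being represented there by `g n`. -/
def PowersRepresentedBy (φ : ℂ → ℂ) (g : ℕ+ → WD) : Prop :=
  ∀ n : ℕ+, Represents (g n) (fun s => ((n : ℕ) : ℂ) ^ (-φ s))

/-- `n^{-φ} ∈ 𝒜⁺` for all `n ≥ 1`, with `‖n^{-φ}‖ ≤ C` for some `C` independent of `n`. -/
def PowersBounded (φ : ℂ → ℂ) : Prop :=
  ∃ g : ℕ+ → WD, PowersRepresentedBy φ g ∧ ∃ C : ℝ, ∀ n, ‖g n‖ ≤ C

/-- `n^{-φ} ∈ 𝒜⁺` for all `n ≥ 1`, and `‖n^{-φ}‖ → 0`. -/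
def PowersTendToZero (φ : ℂ → ℂ) : Prop :=
  ∃ g : ℕ+ → WD, PowersRepresentedBy φ g ∧ Tendsto (fun n => ‖g n‖) atTop (𝓝 0)

end WienerDirichlet

end

open Filter Topology Set

noncomputable section

namespace WienerDirichlet

/-! ### The space `ℓ¹(ℕ+)` and operators on it -/

/-! Since `𝒜⁺` is `ℓ¹`, an operator out of it is determined by a bounded sequence of images of the
basis vectors `n^{-s}` (`WD.synth`), and `C_φ` sends `n^{-s}` to `n^{-φ}`. Part (a) is then the
closed graph theorem plus the open mapping theorem for `φ`. In (b), images with norms tending to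
zero give a norm limit of finite-rank operators, while compactness forces `n^{-φ} → 0` in norm
because every cluster point evaluates to zero pointwise.

The hard direction is (b)(ii). Up to the contraction `n^{-c₀ s}`, the element `n^{-φ}` is `exp(-log
n · a)` with `a = ∑ c_k k^{-s}`. In a commutative Banach algebra this tends to zero once `Re ψ(a) >
0` for all characters `ψ` (`tendsto_norm_exp_neg_smul`). A character gives a completely
multiplicative `χ` with `|χ| ≤ 1` and `ψ(a) = ∑ c_k χ(k)`, so the bound `Re ≥ δ` must pass from the
imaginary axis to all such twists (`le_re_tsum_mul_char`). For summable `χ`, this follows from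
averaging against the nonnegative weight `|∑ χ(n) n^{it}|²`, whose mean reproduces `∑ c_k χ(k)` up
to a positive factor. -/

theorem WD.hasSum_norm (f : WD) : HasSum (fun n => ‖f n‖) ‖f‖ := by
  simpa using lp.hasSum_norm (p := 1) (by simp) f

/-- The element `n^{-s}` of `𝒜⁺`. -/
def WD.basis (n : ℕ+) : WD := lp.single 1 n (1 : ℂ)

theorem WD.norm_basis (n : ℕ+) : ‖WD.basis n‖ = 1 := by
  simp [WD.basis, lp.norm_single]

theorem WD.hasSum_basis (f : WD) : HasSum (fun n => f n • WD.basis n) f := by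
  have := lp.hasSum_single (p := 1) (by simp) f
  convert this using 2 with n
  rw [WD.basis, ← lp.single_smul]
  simp

theorem WD.clm_ext {E : Type*} [NormedAddCommGroup E] [NormedSpace ℂ E] {S T : WD →L[ℂ] E}
    (h : ∀ n, S (WD.basis n) = T (WD.basis n)) : S = T := by
  ext f
  have hS := (WD.hasSum_basis f).mapL S
  have hT := (WD.hasSum_basis f).mapL T
  simp only [map_smul, h] at hS hT
  exact hS.unique hT

section Synthesis

variable {E : Type*} [NormedAddCommGroup E] [NormedSpace ℂ E]

theorem WD.summable_norm_smul {g : ℕ+ → E} {C : ℝ} (hg : ∀ n, ‖g n‖ ≤ C) (f : WD) :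
    Summable fun n => ‖f n • g n‖ := by
  refine Summable.of_nonneg_of_le (fun n => norm_nonneg _) (fun n => ?_)
    (f.hasSum_norm.summable.mul_right C)
  rw [norm_smul]
  exact mul_le_mul_of_nonneg_left (hg n) (norm_nonneg _)

variable [CompleteSpace E]

/-- The operator on `ℓ¹` sending the basis vectors to a given bounded sequence. -/
def WD.synth (g : ℕ+ → E) (C : ℝ) (hg : ∀ n, ‖g n‖ ≤ C) : WD →L[ℂ] E :=
  LinearMap.mkContinuous
    { toFun := fun f => ∑' n, f n • g n
      map_add' := fun f₁ f₂ => by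
        rw [← (WD.summable_norm_smul hg f₁).of_norm.tsum_add (WD.summable_norm_smul hg f₂).of_norm]
        simp [add_smul]
      map_smul' := fun c f => by
        simp only [RingHom.id_apply]
        rw [← (WD.summable_norm_smul hg f).of_norm.tsum_const_smul]
        simp [mul_smul] } C
    (fun f => by
      refine (tsum_of_norm_bounded (f.hasSum_norm.mul_right C) fun n => ?_).trans_eq (mul_comm _ _)
      rw [norm_smul]
      exact mul_le_mul_of_nonneg_left (hg n) (norm_nonneg _))

theorem WD.hasSum_synth {g : ℕ+ → E} {C : ℝ} (hg : ∀ n, ‖g n‖ ≤ C) (f : WD) :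
    HasSum (fun n => f n • g n) (WD.synth g C hg f) :=
  (WD.summable_norm_smul hg f).of_norm.hasSum

theorem WD.norm_synth_le {g : ℕ+ → E} {C : ℝ} (hg : ∀ n, ‖g n‖ ≤ C) :
    ‖WD.synth g C hg‖ ≤ C :=
  LinearMap.mkContinuous_norm_le _ ((norm_nonneg _).trans (hg 1)) _

@[simp]
theorem WD.synth_basis {g : ℕ+ → E} {C : ℝ} (hg : ∀ n, ‖g n‖ ≤ C) (n : ℕ+) :
    WD.synth g C hg (WD.basis n) = g n := by
  refine (WD.hasSum_synth hg _).unique ?_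
  convert hasSum_single n ?_ using 1
  · simp [WD.basis]
  · intro m hm
    simp [WD.basis, hm]

end Synthesis

/-! ### Evaluation -/

theorem norm_pnat_cpow_neg (n : ℕ+) (s : ℂ) :
    ‖((n : ℕ) : ℂ) ^ (-s)‖ = ((n : ℕ) : ℝ) ^ (-s.re) := by
  simpa using Complex.norm_natCast_cpow_of_pos n.pos (-s)

theorem norm_pnat_cpow_neg_le_one (n : ℕ+) {s : ℂ} (hs : 0 ≤ s.re) :
    ‖((n : ℕ) : ℂ) ^ (-s)‖ ≤ 1 := by
  rw [norm_pnat_cpow_neg]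
  exact Real.rpow_le_one_of_one_le_of_nonpos (Nat.one_le_cast.2 n.pos) (by linarith)

/-- Evaluation at a point of the closed right half-plane, as a bounded functional. -/
def WD.evalCLM (s : ℂ) (hs : 0 ≤ s.re) : WD →L[ℂ] ℂ :=
  WD.synth (fun n => ((n : ℕ) : ℂ) ^ (-s)) 1 fun n => norm_pnat_cpow_neg_le_one n hs

theorem WD.hasSum_eval (f : WD) {s : ℂ} (hs : 0 ≤ s.re) :
    HasSum (fun n : ℕ+ => f n * ((n : ℕ) : ℂ) ^ (-s)) (f.eval s) :=
  (WD.summable_norm_smul (fun n => norm_pnat_cpow_neg_le_one n hs) f).of_norm.hasSum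

theorem WD.evalCLM_apply {s : ℂ} (hs : 0 ≤ s.re) (f : WD) : WD.evalCLM s hs f = f.eval s := rfl

theorem WD.norm_eval_le (f : WD) {s : ℂ} (hs : 0 ≤ s.re) : ‖f.eval s‖ ≤ ‖f‖ := by
  rw [← WD.evalCLM_apply hs]
  simpa using (WD.evalCLM s hs).le_of_opNorm_le (WD.norm_synth_le _) f

@[simp]
theorem WD.eval_basis (n : ℕ+) {s : ℂ} (hs : 0 ≤ s.re) :
    (WD.basis n).eval s = ((n : ℕ) : ℂ) ^ (-s) := by
  rw [← WD.evalCLM_apply hs, WD.evalCLM, WD.synth_basis]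

/-- An element of `𝒜⁺` is determined by its function on the right half-plane. -/
theorem WD.eq_zero_of_eval (f : WD) (h : ∀ s ∈ halfPlane 0, f.eval s = 0) : f = 0 := by
  -- Extension by zero to index `0` makes the uniqueness theorem for L-series applicable.
  let a : ℕ → ℂ := fun n => if hn : 0 < n then f ⟨n, hn⟩ else 0
  have ha : ∀ n : ℕ+, a n = f n := fun n => by
    simp only [a, n.pos, dif_pos]
    rfl
  have key : ∀ s : ℂ, 0 < s.re → HasSum (LSeries.term a s) (f.eval s) := by
    intro s hs
    have h1 := f.hasSum_eval hs.le
    have h2 : HasSum (fun n : ℕ+ => LSeries.term a s n) (f.eval s) := by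
      convert h1 using 2 with n
      rw [LSeries.term_of_ne_zero n.ne_zero, ha, Complex.cpow_neg, div_eq_mul_inv]
    refine (Function.Injective.hasSum_iff PNat.coe_injective ?_).1 h2
    intro n hn
    have : n = 0 := by
      by_contra h0
      exact hn ⟨⟨n, Nat.pos_of_ne_zero h0⟩, rfl⟩
    simp [this]
  have hab : LSeries.abscissaOfAbsConv a < ⊤ :=
    (LSeriesSummable.abscissaOfAbsConv_le (s := 1) (key 1 (by simp)).summable).trans_lt
      (EReal.coe_lt_top 1)
  have h0 : LSeries.abscissaOfAbsConv (0 : ℕ → ℂ) < ⊤ :=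
    (LSeriesSummable.abscissaOfAbsConv_le (s := 1) LSeriesSummable_zero).trans_lt
      (EReal.coe_lt_top 1)
  ext n
  rw [← ha, LSeries.eq_of_LSeries_eventually_eq hab h0 ?_ n.ne_zero]
  · rfl
  · filter_upwards [eventually_gt_atTop 0] with x hx
    have := (key x (by simpa using hx)).tsum_eq
    rw [LSeries, this, h _ (by simpa [halfPlane] using hx)]
    simp

theorem WD.eq_of_eval {f g : WD} (h : ∀ s ∈ halfPlane 0, f.eval s = g.eval s) : f = g := by
  rw [← sub_eq_zero]
  refine WD.eq_zero_of_eval _ fun s hs => ?_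
  have hs' : 0 ≤ s.re := le_of_lt hs
  rw [← WD.evalCLM_apply hs', map_sub, WD.evalCLM_apply, WD.evalCLM_apply, h s hs, sub_self]

/-! ### Boundedness of composition operators -/

theorem isOpen_halfPlane (θ : ℝ) : IsOpen (halfPlane θ) :=
  isOpen_lt continuous_const Complex.continuous_re

theorem isPreconnected_halfPlane (θ : ℝ) : IsPreconnected (halfPlane θ) :=
  (convex_halfSpace_re_gt θ).isPreconnected

/-- If `Re w < 0`, the coefficients `2^{k Re w}` placed at the powers `2^k` are summable, yet every
resulting term has modulus `1`. -/
theorem re_nonneg_of_forall_summable {w : ℂ}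
    (h : ∀ f : WD, Summable fun n : ℕ+ => f n * ((n : ℕ) : ℂ) ^ (-w)) : 0 ≤ w.re := by
  by_contra! hw
  have hinj : Function.Injective (fun k : ℕ => (2 : ℕ+) ^ k) := by
    intro k l hkl
    have : (2 : ℕ) ^ k = 2 ^ l := by
      simpa using congrArg PNat.val hkl
    exact Nat.pow_right_injective le_rfl this
  let r : ℝ := (2 : ℝ) ^ w.re
  have hr0 : 0 < r := Real.rpow_pos_of_pos two_pos _
  have hr1 : r < 1 := Real.rpow_lt_one_of_one_lt_of_neg one_lt_two hw
  let a : ℕ+ → ℂ := Function.extend (fun k : ℕ => (2 : ℕ+) ^ k) (fun k => ((r ^ k : ℝ) : ℂ)) 0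
  have ha : ∀ k : ℕ, a (2 ^ k) = ((r ^ k : ℝ) : ℂ) := fun k => hinj.extend_apply _ _ k
  have hsum : Summable fun n => ‖a n‖ := by
    refine (hinj.summable_iff ?_).1 ?_
    · intro n hn
      have : a n = 0 := Function.extend_apply' _ _ _ (by simpa using hn)
      simp [this]
    · have : ((fun n => ‖a n‖) ∘ fun k : ℕ => (2 : ℕ+) ^ k) = fun k => r ^ k := by
        ext k
        simp [ha, abs_of_pos hr0]
      rw [this]
      exact summable_geometric_of_lt_one hr0.le hr1
  let f : WD := ⟨a, memℓp_gen (by simpa using hsum)⟩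
  have h1 := ((h f).comp_injective hinj).norm.tendsto_atTop_zero
  have h2 : ∀ k : ℕ, ‖((fun n : ℕ+ => f n * ((n : ℕ) : ℂ) ^ (-w)) ∘
      fun k : ℕ => (2 : ℕ+) ^ k) k‖ = 1 := by
    intro k
    have hf : f (2 ^ k) = ((r ^ k : ℝ) : ℂ) := ha k
    simp only [Function.comp_apply, norm_mul, hf]
    rw [norm_pnat_cpow_neg, PNat.pow_coe, Nat.cast_pow, Complex.norm_real, Real.norm_of_nonneg (by positivity), ← Real.rpow_natCast,
      ← Real.rpow_natCast, ← Real.rpow_mul (by positivity), ← Real.rpow_mul (by positivity)]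
    simp only [PNat.val_ofNat, Nat.cast_ofNat]
    rw [← Real.rpow_add two_pos]
    ring_nf
    simp
  simp only [h2] at h1
  exact one_ne_zero (tendsto_nhds_unique tendsto_const_nhds h1)

theorem IsComp.unique {φ : ℂ → ℂ} {f g₁ g₂ : WD} (h₁ : IsComp φ f g₁) (h₂ : IsComp φ f g₂) :
    g₁ = g₂ :=
  WD.eq_of_eval fun s hs => (h₁ s hs).unique (h₂ s hs)

/-- Closed graph theorem: evaluations at `s` and at `φ s` are continuous, and evaluations separate
points. It is enough here that `φ s` lies in the closed half-plane. -/
theorem CompMapsInto.compBounded {φ : ℂ → ℂ} (h : CompMapsInto φ) : CompBounded φ := by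
  have hre : ∀ s ∈ halfPlane 0, 0 ≤ (φ s).re := fun s hs =>
    re_nonneg_of_forall_summable fun f => by
      obtain ⟨g, hg⟩ := h f
      exact (hg s hs).summable
  choose T hT using h
  have hev : ∀ f, ∀ s ∈ halfPlane 0, (T f).eval s = f.eval (φ s) := fun f s hs =>
    (hT f s hs).unique (f.hasSum_eval (hre s hs))
  let L : WD →ₗ[ℂ] WD :=
    { toFun := T
      map_add' := fun f₁ f₂ => WD.eq_of_eval fun s hs => by
        rw [hev _ s hs, ← WD.evalCLM_apply (hre s hs), ← WD.evalCLM_apply (le_of_lt hs), map_add,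
          map_add]
        simp only [WD.evalCLM_apply, hev _ s hs]
      map_smul' := fun c f => WD.eq_of_eval fun s hs => by
        rw [hev _ s hs, ← WD.evalCLM_apply (hre s hs), ← WD.evalCLM_apply (le_of_lt hs), map_smul,
          map_smul]
        simp only [WD.evalCLM_apply, hev _ s hs, RingHom.id_apply] }
  refine ⟨ContinuousLinearMap.ofSeqClosedGraph (g := L) ?_, fun f => hT f⟩
  intro u f g hu hg
  refine WD.eq_of_eval fun s hs => ?_
  change _ = (T f).eval s
  rw [hev f s hs]
  have h1 := ((WD.evalCLM s (le_of_lt hs)).continuous.tendsto g).comp hg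
  have h2 := ((WD.evalCLM (φ s) (hre s hs)).continuous.tendsto f).comp hu
  refine tendsto_nhds_unique h1 (h2.congr fun k => ?_)
  exact (hev (u k) s hs).symm

theorem powersRepresentedBy_of_isComp {φ : ℂ → ℂ} {T : WD →L[ℂ] WD}
    (hT : ∀ f : WD, IsComp φ f (T f)) : PowersRepresentedBy φ fun n => T (WD.basis n) := by
  intro n s hs
  refine (hT _ s hs).unique ?_
  convert hasSum_single n ?_ using 1
  · simp [WD.basis]
  · intro m hm
    simp [WD.basis, hm]

theorem CompBounded.powersBounded {φ : ℂ → ℂ} (h : CompBounded φ) : PowersBounded φ := by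
  obtain ⟨T, hT⟩ := h
  refine ⟨_, powersRepresentedBy_of_isComp hT, ‖T‖, fun n => ?_⟩
  simpa [WD.norm_basis] using T.le_opNorm (WD.basis n)

theorem PowersRepresentedBy.rpow_le {φ : ℂ → ℂ} {g : ℕ+ → WD} (hg : PowersRepresentedBy φ g)
    (n : ℕ+) {s : ℂ} (hs : s ∈ halfPlane 0) : ((n : ℕ) : ℝ) ^ (-(φ s).re) ≤ ‖g n‖ := by
  rw [← norm_pnat_cpow_neg]
  have := (g n).norm_eval_le (le_of_lt hs)
  rwa [hg n hs] at this

theorem PowersBounded.re_nonneg {φ : ℂ → ℂ} (h : PowersBounded φ) {s : ℂ}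
    (hs : s ∈ halfPlane 0) : 0 ≤ (φ s).re := by
  obtain ⟨g, hg, C, hC⟩ := h
  by_contra! hneg
  have h1 := (tendsto_rpow_atTop (neg_pos.2 hneg)).comp tendsto_natCast_atTop_atTop
  obtain ⟨N, hN⟩ := ((h1.eventually_gt_atTop C).and (eventually_gt_atTop 0)).exists
  exact absurd ((hg.rpow_le ⟨N, hN.2⟩ hs).trans (hC _)) (not_le.2 hN.1)

/-- A non-constant analytic map has open image, so an image inside the closed half-plane lies in its
interior. -/
theorem PowersBounded.mapsTo {φ : ℂ → ℂ} (h : PowersBounded φ)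
    (hd : DifferentiableOn ℂ φ (halfPlane 0)) (hnc : ¬ ∃ w : ℂ, ∀ s ∈ halfPlane 0, φ s = w) :
    MapsTo φ (halfPlane 0) (halfPlane 0) := by
  have hopen := ((hd.analyticOnNhd (isOpen_halfPlane 0)).is_constant_or_isOpen
    (isPreconnected_halfPlane 0)).resolve_left hnc _ subset_rfl (isOpen_halfPlane 0)
  have hsub : φ '' halfPlane 0 ⊆ {z | 0 ≤ z.re} := by
    rintro _ ⟨s, hs, rfl⟩
    exact h.re_nonneg hs
  have := interior_maximal hsub hopen
  rw [Complex.interior_setOfPred_le_re] at this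
  exact fun s hs => this ⟨s, hs, rfl⟩

theorem isComp_synth {φ : ℂ → ℂ} {g : ℕ+ → WD}
    (hg : PowersRepresentedBy φ g) {C : ℝ} (hC : ∀ n, ‖g n‖ ≤ C) (f : WD) :
    IsComp φ f (WD.synth g C hC f) := by
  intro s hs
  have := (WD.hasSum_synth hC f).mapL (WD.evalCLM s (le_of_lt hs))
  rw [WD.evalCLM_apply] at this
  convert this using 2 with n
  rw [map_smul, WD.evalCLM_apply, hg n hs, smul_eq_mul]

theorem PowersBounded.compBounded {φ : ℂ → ℂ} (h : PowersBounded φ) : CompBounded φ := by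
  obtain ⟨g, hg, C, hC⟩ := h
  exact ⟨WD.synth g C hC, isComp_synth hg hC⟩

theorem pnat_cofinite_eq_atTop : (cofinite : Filter ℕ+) = atTop := by
  refine le_antisymm ?_ atTop_le_cofinite
  rw [atTop_basis.ge_iff]
  intro n _
  rw [mem_cofinite, compl_Ici]
  exact finite_Iio n

/-! ### Compactness of composition operators -/

theorem CompCompact.compBounded {φ : ℂ → ℂ} (h : CompCompact φ) : CompBounded φ :=
  let ⟨T, hT, _⟩ := h
  ⟨T, hT⟩

theorem PowersTendToZero.powersBounded {φ : ℂ → ℂ} (h : PowersTendToZero φ) :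
    PowersBounded φ := by
  obtain ⟨g, hg, h0⟩ := h
  rw [← pnat_cofinite_eq_atTop] at h0
  obtain ⟨C, hC⟩ := h0.bddAbove_range_of_cofinite
  exact ⟨g, hg, C, fun n => hC ⟨n, rfl⟩⟩

theorem tendsto_pnat_cpow_neg {w : ℂ} (hw : 0 < w.re) :
    Tendsto (fun n : ℕ+ => ((n : ℕ) : ℂ) ^ (-w)) atTop (𝓝 0) := by
  rw [tendsto_zero_iff_norm_tendsto_zero]
  simp only [norm_pnat_cpow_neg]
  exact (tendsto_rpow_neg_atTop hw).comp
    (tendsto_natCast_atTop_atTop.comp tendsto_PNat_val_atTop_atTop)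

/-- The basis of `ℓ¹` is not weakly null, so pointwise evaluation is used instead: the images lie in
a compact set, and their only possible cluster point is `0` because `n^{-φ(s)} → 0` for each `s`. -/
theorem CompCompact.powersTendToZero {φ : ℂ → ℂ} (h : CompCompact φ)
    (hφ : MapsTo φ (halfPlane 0) (halfPlane 0)) : PowersTendToZero φ := by
  obtain ⟨T, hT, hc⟩ := h
  have hrep := powersRepresentedBy_of_isComp hT
  refine ⟨_, hrep, ?_⟩
  rw [← tendsto_zero_iff_norm_tendsto_zero]
  have hK := hc.isCompact_closure_image_closedBall 1
  have hmem : ∀ n, T (WD.basis n) ∈ closure (T '' Metric.closedBall 0 1) := fun n =>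
    subset_closure ⟨_, by simp [WD.norm_basis], rfl⟩
  refine hK.tendsto_nhds_of_unique_mapClusterPt (Eventually.of_forall hmem) ?_
  intro g _ hg
  refine WD.eq_zero_of_eval g fun s hs => ?_
  have h1 := hg.continuousAt_comp
    (WD.evalCLM s (le_of_lt hs)).continuous.continuousAt
  have h2 : Tendsto (⇑(WD.evalCLM s (le_of_lt hs)) ∘ fun n => T (WD.basis n)) atTop (𝓝 0) := by
    refine (tendsto_pnat_cpow_neg (hφ hs)).congr fun n => ?_
    exact (hrep n hs).symm
  have h3 : ClusterPt _ (𝓝 (0 : ℂ)) := ClusterPt.mono h1 h2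
  exact eq_of_nhds_neBot h3

/-- Keeping only the finitely many `g n` of norm at least `ε / 2` gives a finite-rank operator
within `ε / 2` of the original. -/
theorem WD.isCompactOperator_synth {g : ℕ+ → WD} {C : ℝ} (hC : ∀ n, ‖g n‖ ≤ C)
    (h0 : Tendsto (fun n => ‖g n‖) cofinite (𝓝 0)) : IsCompactOperator (WD.synth g C hC) := by
  have hcl := isClosed_setOfPred_isCompactOperator (σ₁₂ := RingHom.id ℂ) (M₁ := WD) (M₂ := WD)
  refine hcl.closure_subset (Metric.mem_closure_iff.2 fun ε hε => ?_)
  have hfin : {n | ¬ ‖g n‖ < ε / 2}.Finite := h0.eventually_lt_const (half_pos hε)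
  have hcoord : ∀ m n : ℕ+, ‖(Pi.single m 1 : ℕ+ → ℂ) n‖ ≤ 1 := fun m n => by
    by_cases h : n = m
    · simp [h]
    · simp [h]
  let S : WD →L[ℂ] WD :=
    ∑ m ∈ hfin.toFinset, (WD.synth (Pi.single m (1 : ℂ)) 1 (hcoord m)).smulRight (g m)
  have hS : S ∈ compactOperator (RingHom.id ℂ) WD WD := by
    refine Submodule.sum_mem _ fun m _ => ?_
    exact (isCompactOperator_of_locallyCompactSpace_rng
      (ContinuousLinearMap.toSpanSingleton ℂ (g m))).comp_clm (WD.synth _ 1 (hcoord m))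
  refine ⟨S, hS, ?_⟩
  have hr : ∀ n, ‖if n ∈ hfin.toFinset then 0 else g n‖ ≤ ε / 2 := fun n => by
    split_ifs with h
    · simpa using (half_pos hε).le
    · simp only [Finite.mem_toFinset, mem_ofPred_eq, not_not] at h
      exact h.le
  have hsub : WD.synth g C hC - S = WD.synth _ _ hr := by
    refine WD.clm_ext fun n => ?_
    have : S (WD.basis n) = if n ∈ hfin.toFinset then g n else 0 := by
      simp [S, Pi.single_apply, ite_smul]
    rw [sub_apply, this, WD.synth_basis, WD.synth_basis]
    split_ifs <;> simp
  rw [dist_eq_norm, hsub]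
  exact (WD.norm_synth_le hr).trans_lt (half_lt_self hε)

theorem PowersTendToZero.compCompact {φ : ℂ → ℂ} (h : PowersTendToZero φ) : CompCompact φ := by
  obtain ⟨g, hg, h0⟩ := h
  rw [← pnat_cofinite_eq_atTop] at h0
  obtain ⟨C, hC⟩ := h0.bddAbove_range_of_cofinite
  replace hC : ∀ n, ‖g n‖ ≤ C := fun n => hC ⟨n, rfl⟩
  refine ⟨WD.synth g C hC, isComp_synth hg hC, ?_⟩
  exact WD.isCompactOperator_synth hC h0

/-- A single `n > 1` with `‖n^{-φ}‖ < 1/2` suffices, since the norm dominates `n^{-Re φ(s)}`; taking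
logarithms gives `δ = log 2 / log n`. -/
theorem PowersTendToZero.exists_mapsTo {φ : ℂ → ℂ} (h : PowersTendToZero φ) :
    ∃ δ : ℝ, 0 < δ ∧ MapsTo φ (halfPlane 0) (halfPlane δ) := by
  obtain ⟨g, hg, h0⟩ := h
  obtain ⟨n, hn, hn1⟩ := ((h0.eventually_lt_const (show (0 : ℝ) < 1 / 2 by norm_num)).and
    (eventually_gt_atTop 1)).exists
  have hn1' : (1 : ℝ) < ((n : ℕ) : ℝ) := by exact_mod_cast hn1
  have hlog : 0 < Real.log ((n : ℕ) : ℝ) := Real.log_pos hn1'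
  refine ⟨Real.log 2 / Real.log ((n : ℕ) : ℝ), div_pos (Real.log_pos one_lt_two) hlog,
    fun s hs => ?_⟩
  have h1 : ((n : ℕ) : ℝ) ^ (-(φ s).re) < 1 / 2 := (hg.rpow_le n hs).trans_lt hn
  have h2 := Real.log_lt_log (by positivity) h1
  rw [Real.log_rpow (by positivity), one_div, Real.log_inv] at h2
  change Real.log 2 / Real.log ((n : ℕ) : ℝ) < (φ s).re
  rw [div_lt_iff₀ hlog]
  linarith

/-! ### Mean values of almost periodic functions -/

/-- The mean of `t ↦ exp (i l t)` over `[0, T]`. -/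
def expMean (l T : ℝ) : ℂ := (T : ℂ)⁻¹ * ∫ t in (0 : ℝ)..T, Complex.exp (l * t * Complex.I)

theorem norm_expMean_le_one (l : ℝ) {T : ℝ} (hT : 0 < T) : ‖expMean l T‖ ≤ 1 := by
  have h := intervalIntegral.norm_integral_le_of_norm_le_const (a := 0) (b := T) (C := 1)
    (f := fun t : ℝ => Complex.exp (l * t * Complex.I)) fun t _ => by
      rw [← Complex.ofReal_mul, Complex.norm_exp_ofReal_mul_I]
  rw [one_mul, sub_zero, abs_of_pos hT] at h
  rw [expMean, norm_mul, norm_inv, Complex.norm_real, Real.norm_of_nonneg hT.le]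
  exact inv_mul_le_one_of_le₀ h hT.le

theorem tendsto_expMean (l : ℝ) :
    Tendsto (expMean l) atTop (𝓝 (if l = 0 then 1 else 0)) := by
  split_ifs with hl
  · refine tendsto_const_nhds.congr' ?_
    filter_upwards [eventually_gt_atTop 0] with T hT
    simp [expMean, hl, hT.ne']
  · have hl' : (l : ℂ) * Complex.I ≠ 0 := by simp [hl]
    have hbound : ∀ᶠ T : ℝ in atTop, ‖expMean l T‖ ≤ T⁻¹ * (2 / |l|) := by
      filter_upwards [eventually_gt_atTop 0] with T hT
      have : (fun t : ℝ => Complex.exp (l * t * Complex.I)) =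
          fun t : ℝ => Complex.exp (l * Complex.I * t) := by
        ext t
        ring_nf
      rw [expMean, this, integral_exp_mul_complex hl', norm_mul, norm_inv, Complex.norm_real,
        Real.norm_of_nonneg hT.le, norm_div]
      have h1 : ‖(l : ℂ) * Complex.I‖ = |l| := by simp
      rw [h1]
      gcongr
      refine (norm_sub_le _ _).trans ?_
      have h2 : ∀ x : ℝ, ‖Complex.exp (l * Complex.I * x)‖ = 1 := fun x => by
        rw [show (l : ℂ) * Complex.I * x = ((l * x : ℝ) : ℂ) * Complex.I by push_cast; ring,
          Complex.norm_exp_ofReal_mul_I]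
      rw [h2, h2]
      norm_num
    refine squeeze_zero_norm' hbound ?_
    simpa using tendsto_inv_atTop_zero.mul_const (2 / |l|)

/-- If an absolutely convergent trigonometric series has nonnegative real part, so does its
constant term. -/
theorem re_tsum_zero_freq_nonneg {ι : Type*} [Countable ι] {a : ι → ℂ} {l : ι → ℝ}
    (ha : Summable fun j => ‖a j‖)
    (h : ∀ t : ℝ, 0 ≤ (∑' j, a j * Complex.exp (l j * t * Complex.I)).re) :
    0 ≤ (∑' j, a j * if l j = 0 then 1 else 0).re := by
  have hnorm : ∀ (j : ι) (t : ℝ), ‖a j * Complex.exp (l j * t * Complex.I)‖ = ‖a j‖ := by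
    intro j t
    rw [norm_mul, ← Complex.ofReal_mul, Complex.norm_exp_ofReal_mul_I, mul_one]
  have hlim : Tendsto (fun T => ∑' j, a j * expMean (l j) T) atTop
      (𝓝 (∑' j, a j * if l j = 0 then 1 else 0)) := by
    refine tendsto_tsum_of_dominated_convergence ha
      (fun j => (tendsto_expMean (l j)).const_mul _) ?_
    filter_upwards [eventually_gt_atTop 0] with T hT j
    rw [norm_mul]
    exact mul_le_of_le_one_right (norm_nonneg _) (norm_expMean_le_one _ hT)
  refine ge_of_tendsto ((Complex.continuous_re.tendsto _).comp hlim) ?_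
  filter_upwards [eventually_gt_atTop 0] with T hT
  have hsum := intervalIntegral.hasSum_integral_of_dominated_convergence
    (μ := MeasureTheory.volume) (a := 0) (b := T)
    (F := fun j (t : ℝ) => a j * Complex.exp (l j * t * Complex.I))
    (f := fun t : ℝ => ∑' j, a j * Complex.exp (l j * t * Complex.I)) (fun j _ => ‖a j‖)
    (fun j => (by fun_prop : Continuous fun t : ℝ =>
      a j * Complex.exp (l j * t * Complex.I)).aestronglyMeasurable)
    (fun j => Eventually.of_forall fun t _ => (hnorm j t).le)
    (Eventually.of_forall fun t _ => ha) (by simp)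
    (Eventually.of_forall fun t _ => Summable.hasSum (.of_norm (by simpa only [hnorm] using ha)))
  have hcont : Continuous fun t : ℝ => ∑' j, a j * Complex.exp (l j * t * Complex.I) :=
    continuous_tsum (fun j => by fun_prop) ha fun j t => (hnorm j t).le
  have heq : ∑' j, a j * expMean (l j) T =
      (T : ℂ)⁻¹ * ∫ t in (0 : ℝ)..T, ∑' j, a j * Complex.exp (l j * t * Complex.I) := by
    rw [← hsum.tsum_eq, ← tsum_mul_left]
    refine tsum_congr fun j => ?_
    rw [intervalIntegral.integral_const_mul, expMean]
    ring
  simp only [Function.comp_apply]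
  rw [heq, ← Complex.ofReal_inv, Complex.re_ofReal_mul]
  refine mul_nonneg (inv_nonneg.2 hT.le) ?_
  have hre := Complex.reCLM.intervalIntegral_comp_comm
    (hcont.intervalIntegrable (μ := MeasureTheory.volume) 0 T)
  simp only [Complex.reCLM_apply] at hre
  rw [← hre]
  exact intervalIntegral.integral_nonneg hT.le fun t _ => h t

/-! ### Multiplicative functionals -/

theorem pnat_cpow_neg_mul_I (n : ℕ+) (t : ℝ) :
    ((n : ℕ) : ℂ) ^ (-(t * Complex.I)) =
      Complex.exp ((-Real.log (n : ℕ) : ℝ) * t * Complex.I) := by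
  rw [Complex.cpow_def_of_ne_zero (by simp), ← Complex.natCast_log]
  congr 1
  push_cast
  ring

theorem neg_log_add_log_eq_zero_iff (k m n : ℕ+) :
    -Real.log (k : ℕ) + (-Real.log (m : ℕ) + Real.log (n : ℕ)) = 0 ↔ n = k * m := by
  have hpos : ∀ j : ℕ+, (0 : ℝ) < (j : ℕ) := fun j => Nat.cast_pos.2 j.pos
  rw [show -Real.log (k : ℕ) + (-Real.log (m : ℕ) + Real.log (n : ℕ)) =
    Real.log (n : ℕ) - (Real.log (k : ℕ) + Real.log (m : ℕ)) by ring, sub_eq_zero,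
    ← Real.log_mul (hpos k).ne' (hpos m).ne', ← Nat.cast_mul, ← PNat.mul_coe]
  constructor
  · intro h
    exact PNat.eq (Nat.cast_injective (Real.log_injOn_pos (hpos n) (hpos (k * m)) h))
  · rintro rfl
    rfl

/-- Expands the series times the weight `|∑ v(n) n^{it}|²` into one trigonometric series, ready for
mean values. -/
theorem tsum_mul_conj_mul_exp {c v : ℕ+ → ℂ} (hc : Summable fun n => ‖c n‖)
    (hv : Summable fun n => ‖v n‖) (t : ℝ) :
    ∑' j : ℕ+ × ℕ+ × ℕ+, c j.1 * ((starRingEnd ℂ) (v j.2.1) * v j.2.2) *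
      Complex.exp ((-Real.log (j.1 : ℕ) + (-Real.log (j.2.1 : ℕ) + Real.log (j.2.2 : ℕ)) : ℝ) * t *
        Complex.I) =
    (∑' n, c n * ((n : ℕ) : ℂ) ^ (-(t * Complex.I))) *
      ((‖∑' n, v n * Complex.exp ((Real.log (n : ℕ) : ℝ) * t * Complex.I)‖ ^ 2 : ℝ) : ℂ) := by
  have hunit : ∀ x t : ℝ, ‖Complex.exp (x * t * Complex.I)‖ = 1 := fun x t => by
    rw [← Complex.ofReal_mul, Complex.norm_exp_ofReal_mul_I]
  let A : ℕ+ → ℂ := fun n => c n * ((n : ℕ) : ℂ) ^ (-(t * Complex.I))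
  let B : ℕ+ → ℂ := fun n => v n * Complex.exp ((Real.log (n : ℕ) : ℝ) * t * Complex.I)
  have hA : Summable fun n => ‖A n‖ := by
    refine hc.congr fun n => ?_
    rw [norm_mul, pnat_cpow_neg_mul_I, hunit, mul_one]
  have hB : Summable fun n => ‖B n‖ := by
    refine hv.congr fun n => ?_
    rw [norm_mul, hunit, mul_one]
  have hB' : Summable fun n => ‖(starRingEnd ℂ) (B n)‖ := by
    refine hB.congr fun n => ?_
    rw [RCLike.norm_conj]
  change _ = (∑' n, A n) * ((‖∑' n, B n‖ ^ 2 : ℝ) : ℂ)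
  rw [Complex.ofReal_pow, ← Complex.conj_mul', Complex.conj_tsum,
    tsum_mul_tsum_of_summable_norm hB' hB, tsum_mul_tsum_of_summable_norm hA (hB'.mul_norm hB)]
  refine tsum_congr fun j => ?_
  simp only [A, B, map_mul, pnat_cpow_neg_mul_I, ← Complex.exp_conj, Complex.conj_ofReal,
    Complex.conj_I, Complex.ofReal_add, add_mul, Complex.exp_add, Complex.ofReal_neg, mul_neg,
    neg_mul]
  ring

/-- Only the triples `(k, m, km)` survive, and multiplicativity turns `conj χ(m) · χ(km)` into `χ(k)
|χ(m)|²`, so the sum factors. -/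
theorem tsum_zero_freq (c : ℕ+ → ℂ) (χ : ℕ+ →* ℂ) (hc : Summable fun n => ‖c n * χ n‖)
    (hχ : Summable fun n => ‖χ n‖ ^ 2) :
    ∑' j : ℕ+ × ℕ+ × ℕ+, c j.1 * ((starRingEnd ℂ) (χ j.2.1) * χ j.2.2) *
      (if -Real.log (j.1 : ℕ) + (-Real.log (j.2.1 : ℕ) + Real.log (j.2.2 : ℕ)) = 0
        then 1 else 0) =
    (∑' n, c n * χ n) * ((∑' n, ‖χ n‖ ^ 2 : ℝ) : ℂ) := by
  have hinj : Function.Injective fun q : ℕ+ × ℕ+ => (q.1, q.2, q.1 * q.2) := by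
    rintro ⟨k, m⟩ ⟨k', m'⟩ h
    simp only [Prod.mk.injEq] at h
    exact Prod.ext h.1 h.2.1
  have hχ' : Summable fun n => ‖((‖χ n‖ ^ 2 : ℝ) : ℂ)‖ := by
    refine hχ.congr fun n => ?_
    rw [Complex.norm_real, Real.norm_of_nonneg (by positivity)]
  rw [Complex.ofReal_tsum, tsum_mul_tsum_of_summable_norm hc hχ', ← hinj.tsum_eq]
  · refine tsum_congr fun q => ?_
    rw [if_pos ((neg_log_add_log_eq_zero_iff _ _ _).2 rfl)]
    simp only [map_mul, Complex.ofReal_pow, ← Complex.conj_mul']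
    ring
  · rintro ⟨k, m, n⟩ hj
    have : n = k * m := by
      by_contra hne
      rw [← neg_log_add_log_eq_zero_iff] at hne
      exact hj (by simp only [hne, if_false, mul_zero])
    exact ⟨(k, m), by rw [this]⟩

theorem re_tsum_mul_char_nonneg_of_summable {c : ℕ+ → ℂ} (hc : Summable fun n => ‖c n‖)
    (h : ∀ t : ℝ, 0 ≤ (∑' n, c n * ((n : ℕ) : ℂ) ^ (-(t * Complex.I))).re)
    (χ : ℕ+ →* ℂ) (h1 : ∀ n, ‖χ n‖ ≤ 1) (hχ : Summable fun n => ‖χ n‖) :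
    0 ≤ (∑' n, c n * χ n).re := by
  have hχc : Summable fun n => ‖(starRingEnd ℂ) (χ n)‖ := by
    refine hχ.congr fun n => ?_
    rw [RCLike.norm_conj]
  have hχ2 : Summable fun n => ‖χ n‖ ^ 2 :=
    hχ.of_nonneg_of_le (fun n => by positivity) fun n => by
      rw [sq]
      exact mul_le_of_le_one_left (norm_nonneg _) (h1 n)
  have hcχ : Summable fun n => ‖c n * χ n‖ :=
    hc.of_nonneg_of_le (fun n => by positivity) fun n => by
      rw [norm_mul]
      exact mul_le_of_le_one_right (norm_nonneg _) (h1 n)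
  have key := re_tsum_zero_freq_nonneg (hc.mul_norm (hχc.mul_norm hχ))
    (l := fun j : ℕ+ × ℕ+ × ℕ+ =>
      -Real.log (j.1 : ℕ) + (-Real.log (j.2.1 : ℕ) + Real.log (j.2.2 : ℕ))) fun t => by
    rw [tsum_mul_conj_mul_exp hc hχ t, Complex.re_mul_ofReal]
    exact mul_nonneg (h t) (by positivity)
  rw [tsum_zero_freq c χ hcχ hχ2, Complex.re_mul_ofReal] at key
  -- The factor `∑ |χ(n)|²` is positive because `χ(1) = 1`.
  refine nonneg_of_mul_nonneg_left key (hχ2.tsum_pos (fun n => by positivity) 1 ?_)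
  simp

/-- Damping of a multiplicative function: restriction to `N`-smooth numbers and multiplication
by `n^{-σ}`. -/
def smoothTwist (χ : ℕ+ →* ℂ) (N : ℕ) (σ : ℝ) : ℕ+ →* ℂ where
  toFun n := open Classical in
    if (n : ℕ) ∈ N.smoothNumbers then χ n * (((n : ℕ) : ℝ) ^ (-σ) : ℝ) else 0
  map_one' := by
    rw [if_pos]
    · simp
    · simp [Nat.mem_smoothNumbers]
  map_mul' m n := by
    by_cases hm : (m : ℕ) ∈ N.smoothNumbers
    · by_cases hn : (n : ℕ) ∈ N.smoothNumbers
      · rw [if_pos hm, if_pos hn, if_pos (PNat.mul_coe m n ▸ Nat.mul_mem_smoothNumbers hm hn),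
          map_mul, PNat.mul_coe, Nat.cast_mul, Real.mul_rpow (Nat.cast_nonneg _) (Nat.cast_nonneg _), Complex.ofReal_mul]
        ring
      · rw [if_neg hn, if_neg, mul_zero]
        exact fun h => hn (Nat.mem_smoothNumbers_of_dvd h (by simp))
    · rw [if_neg hm, if_neg, zero_mul]
      exact fun h => hm (Nat.mem_smoothNumbers_of_dvd h (by simp))

theorem norm_smoothTwist_le (χ : ℕ+ →* ℂ) (hχ : ∀ n, ‖χ n‖ ≤ 1) (N : ℕ) {σ : ℝ} (n : ℕ+) :
    ‖smoothTwist χ N σ n‖ ≤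
      (N.smoothNumbers.indicator (fun k : ℕ => (k : ℝ) ^ (-σ)) (n : ℕ)) := by
  classical
  rw [indicator_apply]
  change ‖ite _ _ _‖ ≤ _
  split_ifs
  · rw [norm_mul, Complex.norm_real, Real.norm_of_nonneg (by positivity)]
    exact mul_le_of_le_one_left (by positivity) (hχ n)
  · simp

theorem norm_smoothTwist_le_one (χ : ℕ+ →* ℂ) (hχ : ∀ n, ‖χ n‖ ≤ 1) (N : ℕ) {σ : ℝ} (hσ : 0 ≤ σ)
    (n : ℕ+) : ‖smoothTwist χ N σ n‖ ≤ 1 := by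
  refine (norm_smoothTwist_le χ hχ N n).trans ?_
  refine indicator_le' (fun k _ => ?_) (fun _ _ => zero_le_one) _
  rcases Nat.eq_zero_or_pos k with rfl | hk
  · simpa using Real.zero_rpow_le_one _
  · exact Real.rpow_le_one_of_one_le_of_nonpos (Nat.one_le_cast.2 hk) (by linarith)

/-- The majorant `n^{-σ}` over `N`-smooth `n` is a finite Euler product of convergent geometric
series, for any `σ > 0`. -/
theorem summable_norm_smoothTwist (χ : ℕ+ →* ℂ) (hχ : ∀ n, ‖χ n‖ ≤ 1) (N : ℕ) {σ : ℝ}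
    (hσ : 0 < σ) : Summable fun n => ‖smoothTwist χ N σ n‖ := by
  let f : ℕ →* ℝ :=
    { toFun := fun k => (k : ℝ) ^ (-σ)
      map_one' := by simp
      map_mul' := fun m n => by
        rw [Nat.cast_mul, Real.mul_rpow (Nat.cast_nonneg _) (Nat.cast_nonneg _)] }
  have hf : ∀ {p : ℕ}, p.Prime → ‖f p‖ < 1 := fun {p} hp => by
    change ‖(p : ℝ) ^ (-σ)‖ < 1
    rw [Real.norm_of_nonneg (by positivity)]
    exact Real.rpow_lt_one_of_one_lt_of_neg (Nat.one_lt_cast.2 hp.one_lt) (by linarith)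
  have h1 := (EulerProduct.summable_and_hasSum_smoothNumbers_prod_primesBelow_geometric hf N).2
  have h2 : Summable (N.smoothNumbers.indicator fun k : ℕ => (k : ℝ) ^ (-σ)) :=
    summable_subtype_iff_indicator.1 h1.summable
  exact (h2.comp_injective PNat.coe_injective).of_nonneg_of_le (fun n => norm_nonneg _)
    fun n => norm_smoothTwist_le χ hχ N n

theorem tendsto_smoothTwist (χ : ℕ+ →* ℂ) (n : ℕ+) :
    Tendsto (fun N : ℕ => smoothTwist χ N (1 / ((N : ℝ) + 1)) n) atTop (𝓝 (χ n)) := by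
  have h1 : Tendsto (fun N : ℕ => ((n : ℕ) : ℝ) ^ (-(1 / ((N : ℝ) + 1)))) atTop (𝓝 1) := by
    have h0 : Tendsto (fun N : ℕ => -(1 / ((N : ℝ) + 1))) atTop (𝓝 0) := by
      simpa using tendsto_one_div_add_atTop_nhds_zero_nat (𝕜 := ℝ) |>.neg
    have hn : ((n : ℕ) : ℝ) ≠ 0 := Nat.cast_ne_zero.2 n.ne_zero
    simpa [Function.comp_def] using (Real.continuousAt_const_rpow hn).tendsto.comp h0
  have h2 := ((Complex.continuous_ofReal.tendsto _).comp h1).const_mul (χ n)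
  rw [Complex.ofReal_one, mul_one] at h2
  refine h2.congr' ?_
  filter_upwards [eventually_gt_atTop (n : ℕ)] with N hN
  change _ = ite _ _ _
  rw [if_pos (Nat.mem_smoothNumbers_of_lt n.pos hN)]
  rfl

/-- A lower bound for the real part of an absolutely convergent Dirichlet series on the imaginary
axis is inherited by all its twists with completely multiplicative functions of modulus at
most `1`. -/
theorem le_re_tsum_mul_char {c : ℕ+ → ℂ} (hc : Summable fun n => ‖c n‖) {δ : ℝ}
    (h : ∀ t : ℝ, δ ≤ (∑' n, c n * ((n : ℕ) : ℂ) ^ (-(t * Complex.I))).re)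
    (χ : ℕ+ →* ℂ) (hχ : ∀ n, ‖χ n‖ ≤ 1) : δ ≤ (∑' n, c n * χ n).re := by
  have hs : ∀ u : ℕ+ → ℂ, (∀ n, ‖u n‖ ≤ 1) → Summable fun n => ‖c n * u n‖ := fun u hu =>
    hc.of_nonneg_of_le (fun n => norm_nonneg _) fun n => by
      rw [norm_mul]
      exact mul_le_of_le_one_right (norm_nonneg _) (hu n)
  -- As `χ(1) = 1`, lowering the first coefficient by `δ` reduces the claim to a lower bound of
  -- zero.
  let d : ℕ+ → ℂ := Pi.single 1 (δ : ℂ)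
  have hd : ∀ u : ℕ+ → ℂ, HasSum (fun n => d n * u n) (δ * u 1) := fun u => by
    convert hasSum_single (1 : ℕ+) ?_ using 1
    · simp [d]
    · intro n hn
      simp [d, hn]
  have hsub : ∀ u : ℕ+ → ℂ, u 1 = 1 → (∀ n, ‖u n‖ ≤ 1) →
      (∑' n, (c n - d n) * u n).re = (∑' n, c n * u n).re - δ := fun u hu1 hu => by
    have := ((hs u hu).of_norm.hasSum.sub (hd u)).tsum_eq
    simp only [sub_mul]
    rw [this, hu1, mul_one, Complex.sub_re, Complex.ofReal_re]
  have hcd : Summable fun n => ‖c n - d n‖ := by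
    refine (hc.of_norm.sub ?_).norm
    simpa using (hd 1).summable
  have hN : ∀ N : ℕ, 0 ≤ (∑' n, (c n - d n) * smoothTwist χ N (1 / ((N : ℝ) + 1)) n).re := by
    intro N
    have hσ : 0 < 1 / ((N : ℝ) + 1) := by positivity
    refine re_tsum_mul_char_nonneg_of_summable hcd (fun t => ?_) _
      (norm_smoothTwist_le_one χ hχ N hσ.le) (summable_norm_smoothTwist χ hχ N hσ)
    rw [hsub _ (by simp) fun n => norm_pnat_cpow_neg_le_one n (by simp)]
    exact sub_nonneg.2 (h t)
  have hlim : Tendsto (fun N : ℕ => ∑' n, (c n - d n) * smoothTwist χ N (1 / ((N : ℝ) + 1)) n) atTop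
      (𝓝 (∑' n, (c n - d n) * χ n)) := by
    refine tendsto_tsum_of_dominated_convergence hcd
      (fun n => (tendsto_smoothTwist χ n).const_mul _) (Eventually.of_forall fun N n => ?_)
    rw [norm_mul]
    exact mul_le_of_le_one_right (norm_nonneg _)
      (norm_smoothTwist_le_one χ hχ N (by positivity) n)
  have := ge_of_tendsto' ((Complex.continuous_re.tendsto _).comp hlim) hN
  rw [hsub _ (map_one χ) hχ] at this
  linarith

/-! ### Decay of exponentials in Banach algebras -/

/-- Gelfand's formula gives geometric decay at any rate strictly between the spectral radius and
`1`. -/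
theorem tendsto_norm_pow_of_spectralRadius_lt_one {A : Type*} [NormedRing A] [NormedAlgebra ℂ A]
    [CompleteSpace A] {b : A} (hb : spectralRadius ℂ b < 1) :
    Tendsto (fun n : ℕ => ‖b ^ n‖) atTop (𝓝 0) := by
  obtain ⟨r, hr, hr1⟩ := ENNReal.lt_iff_exists_nnreal_btwn.1 hb
  have hr1' : (r : ℝ) < 1 := by exact_mod_cast hr1
  have h := (spectrum.pow_norm_pow_one_div_tendsto_nhds_spectralRadius b).eventually_lt_const hr
  refine squeeze_zero' (Eventually.of_forall fun n => norm_nonneg _) ?_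
    (tendsto_pow_atTop_nhds_zero_of_lt_one r.coe_nonneg hr1')
  filter_upwards [h, eventually_gt_atTop 0] with n hn hn0
  have h1 : ‖b ^ n‖ ^ (1 / n : ℝ) < r := by
    rw [← ENNReal.ofReal_coe_nnreal] at hn
    exact (ENNReal.ofReal_lt_ofReal_iff_of_nonneg (by positivity)).1 hn
  have hn' : (n : ℝ) ≠ 0 := Nat.cast_ne_zero.2 hn0.ne'
  calc ‖b ^ n‖ = (‖b ^ n‖ ^ (1 / n : ℝ)) ^ n := by
        rw [← Real.rpow_natCast, ← Real.rpow_mul (norm_nonneg _), one_div_mul_cancel hn',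
          Real.rpow_one]
    _ ≤ (r : ℝ) ^ n := pow_le_pow_left₀ (by positivity) h1.le n

theorem tendsto_norm_exp_neg_smul {A : Type*} [NormedCommRing A] [NormedAlgebra ℂ A]
    [CompleteSpace A] [Nontrivial A] {a : A}
    (ha : ∀ ψ : WeakDual.characterSpace ℂ A, 0 < (ψ a).re) :
    Tendsto (fun t : ℝ => ‖NormedSpace.exp (-(t : ℂ) • a)‖) atTop (𝓝 0) := by
  let _ : NormedAlgebra ℚ A := NormedAlgebra.restrictScalars ℚ ℂ A
  -- The spectrum is the set of values `exp(-ψ a)`; by its compactness, pointwise positivity of `Re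
  -- ψ a` yields a strict bound on the radius.
  have hrad : spectralRadius ℂ (NormedSpace.exp (-a)) < 1 := by
    refine spectrum.spectralRadius_lt_of_forall_lt _ (r := 1) fun z hz => ?_
    obtain ⟨ψ, rfl⟩ := WeakDual.CharacterSpace.mem_spectrum_iff_exists.1 hz
    have h1 : ψ (NormedSpace.exp (-a)) = Complex.exp (-ψ a) := by
      rw [NormedSpace.map_exp ψ (map_continuous ψ), map_neg, Complex.exp_eq_exp_ℂ]
    rw [← NNReal.coe_lt_coe, coe_nnnorm, h1, Complex.norm_exp]
    simpa using ha ψ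
  have hpow := (tendsto_norm_pow_of_spectralRadius_lt_one hrad).comp
    (tendsto_nat_floor_atTop (α := ℝ))
  have hcont : Continuous fun t : ℝ => ‖NormedSpace.exp (-(t : ℂ) • a)‖ :=
    (NormedSpace.exp_continuous.comp (by fun_prop)).norm
  obtain ⟨C, hC⟩ := (isCompact_Icc (a := (0 : ℝ)) (b := 1)).bddAbove_image hcont.continuousOn
  have hlim := hpow.mul_const C
  rw [zero_mul] at hlim
  refine squeeze_zero' (Eventually.of_forall fun t => norm_nonneg _) ?_ hlim
  filter_upwards [eventually_ge_atTop 0] with t ht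
  -- Integer powers decay, and the fractional part of `t` contributes a factor bounded on `[0, 1]`.
  have hsplit : NormedSpace.exp (-(t : ℂ) • a) =
      NormedSpace.exp (-a) ^ ⌊t⌋₊ * NormedSpace.exp (-((t - ⌊t⌋₊ : ℝ) : ℂ) • a) := by
    rw [← NormedSpace.exp_nsmul, ← NormedSpace.exp_add]
    congr 1
    rw [← Nat.cast_smul_eq_nsmul ℂ]
    push_cast
    module
  rw [hsplit]
  refine (norm_mul_le _ _).trans (mul_le_mul_of_nonneg_left ?_ (norm_nonneg _))
  refine hC ⟨t - ⌊t⌋₊, ⟨sub_nonneg.2 (Nat.floor_le ht), ?_⟩, rfl⟩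
  linarith [Nat.lt_floor_add_one t]

/-- Gelfand theory needs commutativity, so it is applied in the closed subalgebra generated by the
commuting `M n`. There each character composed with `M` is a completely multiplicative function of
modulus at most `1`. -/
theorem tendsto_norm_exp_neg_smul_tsum {B : Type*} [NormedRing B] [NormedAlgebra ℂ B]
    [CompleteSpace B] [NormOneClass B] (M : ℕ+ →* B) (hM : ∀ n, ‖M n‖ ≤ 1) {c : ℕ+ → ℂ}
    (hc : Summable fun n => ‖c n‖) {δ : ℝ} (hδ : 0 < δ)
    (h : ∀ t : ℝ, δ ≤ (∑' n, c n * ((n : ℕ) : ℂ) ^ (-(t * Complex.I))).re) :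
    Tendsto (fun t : ℝ => ‖NormedSpace.exp (-(t : ℂ) • ∑' n, c n • M n)‖) atTop (𝓝 0) := by
  let S : Subalgebra ℂ B := Algebra.adjoin ℂ (range M)
  have hS : ∀ x y : S, x * y = y * x := by
    have hcomm : ∀ a ∈ range M, ∀ b ∈ range M, a * b = b * a := by
      rintro _ ⟨m, rfl⟩ _ ⟨n, rfl⟩
      rw [← map_mul, ← map_mul, mul_comm]
    exact (Algebra.isMulCommutative_adjoin ℂ hcomm).is_comm.comm
  let A : Subalgebra ℂ B := S.topologicalClosure
  let _ : NormedCommRing A :=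
    { (inferInstance : NormedRing A) with
      mul_comm := (S.commRingTopologicalClosure hS).mul_comm }
  have : CompleteSpace A := S.isClosed_topologicalClosure.completeSpace_coe
  let _ : NormedAlgebra ℚ A := NormedAlgebra.restrictScalars ℚ ℂ A
  let _ : NormedAlgebra ℚ B := NormedAlgebra.restrictScalars ℚ ℂ B
  have : NormOneClass A := ⟨norm_one (α := B)⟩
  have : Nontrivial A := NormOneClass.nontrivial
  let M' : ℕ+ →* A :=
    M.codRestrict A fun n => S.le_topologicalClosure (Algebra.subset_adjoin ⟨n, rfl⟩)
  have hM' : ∀ n, ‖M' n‖ ≤ 1 := hM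
  have hsum : Summable fun n => c n • M' n := by
    refine Summable.of_norm (hc.of_nonneg_of_le (fun n => norm_nonneg _) fun n => ?_)
    rw [norm_smul]
    exact mul_le_of_le_one_right (norm_nonneg _) (hM' n)
  have key := tendsto_norm_exp_neg_smul (a := ∑' n, c n • M' n) fun ψ => by
    have h1 := (hsum.hasSum.map ψ (map_continuous ψ)).tsum_eq
    rw [← h1]
    refine hδ.trans_le ?_
    have h2 := le_re_tsum_mul_char hc h
      ((ψ : A →* ℂ).comp M') fun n => (AlgHom.norm_apply_le_self ψ (M' n)).trans (hM' n)
    simpa [Function.comp_def] using h2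
  refine key.congr fun t => ?_
  -- The isometric inclusion into `B` commutes with the exponential, so the decay transfers back.
  have hval : Continuous A.val := continuous_subtype_val
  have h3 : ((∑' n, c n • M' n : A) : B) = ∑' n, c n • M n :=
    ((hsum.hasSum.map A.val hval).tsum_eq).symm
  have h4 := NormedSpace.map_exp A.val hval (-(t : ℂ) • ∑' n, c n • M' n)
  rw [map_smul] at h4
  change ((NormedSpace.exp (-(t : ℂ) • ∑' n, c n • M' n) : A) : B) = _ at h4
  rw [show A.val (∑' n, c n • M' n) = ∑' n, c n • M n from h3] at h4
  rw [← h4]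
  rfl

/-! ### Multiplication operators on `𝒜⁺` -/

/-- Multiplication by `k^{-s}` on `𝒜⁺`. -/
def WD.shift : ℕ+ →* (WD →L[ℂ] WD) where
  toFun k := WD.synth (fun n => WD.basis (k * n)) 1 fun n => (WD.norm_basis _).le
  map_one' := WD.clm_ext fun n => by simp
  map_mul' k l := WD.clm_ext fun n => by simp [mul_assoc]

theorem WD.shift_basis (k n : ℕ+) : WD.shift k (WD.basis n) = WD.basis (k * n) :=
  WD.synth_basis (fun _ => (WD.norm_basis _).le) n

theorem WD.norm_shift_le (k : ℕ+) : ‖WD.shift k‖ ≤ 1 :=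
  WD.norm_synth_le fun _ => (WD.norm_basis _).le

/-- Evaluation at `s` is a common left eigenvector of all shifts, which lets functions of shifts be
evaluated pointwise. -/
theorem WD.evalCLM_comp_shift {s : ℂ} (hs : 0 ≤ s.re) (k : ℕ+) :
    (WD.evalCLM s hs).comp (WD.shift k) = ((k : ℕ) : ℂ) ^ (-s) • WD.evalCLM s hs := by
  refine WD.clm_ext fun n => ?_
  rw [ContinuousLinearMap.comp_apply, WD.shift_basis, smul_apply,
    WD.evalCLM_apply, WD.evalCLM_apply, WD.eval_basis _ hs, WD.eval_basis _ hs, smul_eq_mul,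
    PNat.mul_coe, Nat.cast_mul, Complex.natCast_mul_natCast_cpow]

theorem summable_mul_pnat_cpow_neg {c : ℕ+ → ℂ} (hc : Summable fun n => ‖c n‖) {s : ℂ}
    (hs : 0 ≤ s.re) : Summable fun n => c n * ((n : ℕ) : ℂ) ^ (-s) := by
  refine Summable.of_norm (hc.of_nonneg_of_le (fun n => norm_nonneg _) fun n => ?_)
  rw [norm_mul]
  exact mul_le_of_le_one_right (norm_nonneg _) (norm_pnat_cpow_neg_le_one n hs)

theorem summable_smul_shift {c : ℕ+ → ℂ} (hc : Summable fun n => ‖c n‖) :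
    Summable fun n => c n • WD.shift n := by
  refine Summable.of_norm (hc.of_nonneg_of_le (fun n => norm_nonneg _) fun n => ?_)
  rw [norm_smul]
  exact mul_le_of_le_one_right (norm_nonneg _) (WD.norm_shift_le n)

theorem WD.evalCLM_comp_tsum_shift {s : ℂ} (hs : 0 ≤ s.re) {c : ℕ+ → ℂ}
    (hc : Summable fun n => ‖c n‖) :
    (WD.evalCLM s hs).comp (∑' n, c n • WD.shift n) =
      (∑' n, c n * ((n : ℕ) : ℂ) ^ (-s)) • WD.evalCLM s hs := by
  have h1 := (summable_smul_shift hc).hasSum.mapL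
    (ContinuousLinearMap.compL ℂ WD WD ℂ (WD.evalCLM s hs))
  refine h1.unique ?_
  convert (summable_mul_pnat_cpow_neg hc hs).hasSum.smul_const
    (WD.evalCLM s hs) using 2 with n
  rw [map_smul, ContinuousLinearMap.compL_apply, WD.evalCLM_comp_shift, smul_smul]

/-- A left eigenvector of an operator is a left eigenvector of its exponential. -/
theorem comp_exp_of_comp_eq_smul {E F : Type*} [NormedAddCommGroup E] [NormedSpace ℂ E]
    [CompleteSpace E] [NormedAddCommGroup F] [NormedSpace ℂ F] {L : E →L[ℂ] F} {T : E →L[ℂ] E}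
    {z : ℂ} (h : L.comp T = z • L) : L.comp (NormedSpace.exp T) = Complex.exp z • L := by
  have hpow : ∀ n : ℕ, L.comp (T ^ n) = z ^ n • L := by
    intro n
    induction n with
    | zero => ext; simp
    | succ n ih =>
      rw [pow_succ, ContinuousLinearMap.mul_def, ← ContinuousLinearMap.comp_assoc, ih,
        ContinuousLinearMap.smul_comp, h, smul_smul, pow_succ]
  have h1 := (NormedSpace.exp_series_hasSum_exp' (𝕂 := ℂ) T).mapL
    (ContinuousLinearMap.compL ℂ E E F L)
  have h2 := (NormedSpace.exp_series_hasSum_exp' (𝕂 := ℂ) z).smul_const L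
  rw [← Complex.exp_eq_exp_ℂ] at h2
  refine h1.unique ?_
  convert h2 using 2 with n
  rw [map_smul, ContinuousLinearMap.compL_apply, hpow, smul_smul, smul_eq_mul]

/-! ### Absolutely convergent symbols -/

/-- Both sides are analytic on the right half-plane and agree far to the right, so the identity
theorem applies. -/
theorem HasDirichletExpansion.eqOn_tsum {ϕ : ℂ → ℂ} (hd : DifferentiableOn ℂ ϕ (halfPlane 0))
    {c : ℕ+ → ℂ} (h : HasDirichletExpansion ϕ c) (hc : Summable fun n => ‖c n‖) :
    EqOn ϕ (fun s => ∑' n, c n * ((n : ℕ) : ℂ) ^ (-s)) (halfPlane 0) := by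
  obtain ⟨σ, hσ⟩ := h
  have hd' : DifferentiableOn ℂ (fun s => ∑' n, c n * ((n : ℕ) : ℂ) ^ (-s)) (halfPlane 0) := by
    refine Complex.differentiableOn_tsum_of_summable_norm hc (fun n => ?_) (isOpen_halfPlane 0) ?_
    · have hn : ((n : ℕ) : ℂ) ≠ 0 := Nat.cast_ne_zero.2 n.ne_zero
      exact fun s _ => ((differentiableAt_id.neg.const_cpow (Or.inl hn)).const_mul
        (c n)).differentiableWithinAt
    · intro n s hs
      rw [norm_mul]
      exact mul_le_of_le_one_right (norm_nonneg _) (norm_pnat_cpow_neg_le_one n (le_of_lt hs))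
  have hmem : ((max σ 0 + 1 : ℝ) : ℂ) ∈ halfPlane (max σ 0) := by
    change max σ 0 < max σ 0 + 1
    exact lt_add_one _
  have hsub : halfPlane (max σ 0) ⊆ halfPlane 0 := fun s hs => (le_max_right σ 0).trans_lt hs
  refine (hd.analyticOnNhd (isOpen_halfPlane 0)).eqOn_of_preconnected_of_eventuallyEq
    (hd'.analyticOnNhd (isOpen_halfPlane 0)) (isPreconnected_halfPlane 0) (hsub hmem) ?_
  filter_upwards [(isOpen_halfPlane (max σ 0)).mem_nhds hmem] with s hs
  refine tendsto_nhds_unique (hσ s ((le_max_left σ 0).trans_lt hs)) ?_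
  refine (summable_mul_pnat_cpow_neg hc (le_of_lt (hsub hs))).hasSum.comp ?_
  refine tendsto_atTop_finset_of_monotone (fun M N hMN => Finset.Icc_subset_Icc_right hMN) ?_
  exact fun n => ⟨n, Finset.mem_Icc.2 ⟨n.pos, le_rfl⟩⟩

/-- Let `s → it` from the right: the term `c₀ s` becomes purely imaginary and drops out of the real
part. -/
theorem le_re_tsum_mul_cpow_neg_mul_I {c₀ : ℕ} {c : ℕ+ → ℂ} (hc : Summable fun n => ‖c n‖) {δ : ℝ}
    (h : ∀ s ∈ halfPlane 0, δ < ((c₀ : ℂ) * s + ∑' n, c n * ((n : ℕ) : ℂ) ^ (-s)).re) (t : ℝ) :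
    δ ≤ (∑' n, c n * ((n : ℕ) : ℂ) ^ (-(t * Complex.I))).re := by
  have hs : Tendsto (fun σ : ℝ => (σ : ℂ) + t * Complex.I) (𝓝[>] 0) (𝓝 (t * Complex.I)) := by
    have : Continuous fun σ : ℝ => (σ : ℂ) + t * Complex.I := by fun_prop
    simpa using (this.tendsto 0).mono_left nhdsWithin_le_nhds
  have hpos : ∀ᶠ σ : ℝ in 𝓝[>] 0, (σ : ℂ) + t * Complex.I ∈ halfPlane 0 := by
    filter_upwards [self_mem_nhdsWithin] with σ hσ
    simpa [halfPlane] using hσ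
  have hlim : Tendsto (fun σ : ℝ => ∑' n, c n * ((n : ℕ) : ℂ) ^ (-((σ : ℂ) + t * Complex.I)))
      (𝓝[>] 0) (𝓝 (∑' n, c n * ((n : ℕ) : ℂ) ^ (-(t * Complex.I)))) := by
    refine tendsto_tsum_of_dominated_convergence hc (fun n => ?_) ?_
    · have hn : ((n : ℕ) : ℂ) ≠ 0 := Nat.cast_ne_zero.2 n.ne_zero
      exact (hs.neg.const_cpow (Or.inl hn)).const_mul _
    · filter_upwards [hpos] with σ hσ n
      rw [norm_mul]
      exact mul_le_of_le_one_right (norm_nonneg _) (norm_pnat_cpow_neg_le_one n (le_of_lt hσ))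
  have hre := (Complex.continuous_re.tendsto _).comp ((hs.const_mul (c₀ : ℂ)).add hlim)
  have h0 : ((c₀ : ℂ) * (t * Complex.I) + ∑' n, c n * ((n : ℕ) : ℂ) ^ (-(t * Complex.I))).re =
      (∑' n, c n * ((n : ℕ) : ℂ) ^ (-(t * Complex.I))).re := by
    simp
  rw [h0] at hre
  refine ge_of_tendsto hre ?_
  filter_upwards [hpos] with σ hσ
  exact (h _ hσ).le

/-- The element `n^{-φ}` is obtained by applying the shift by `n^{c₀}` and `exp(-log n · ∑ c_k •
shift k)` to the unit `1^{-s}`. The shift is a contraction, so operator-norm decay of the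
exponential suffices. -/
theorem powersTendToZero_of_mapsTo {c₀ : ℕ} {φ : ℂ → ℂ} {c : ℕ+ → ℂ}
    (hc : Summable fun n => ‖c n‖)
    (hφ : ∀ s ∈ halfPlane 0, φ s = (c₀ : ℂ) * s + ∑' n, c n * ((n : ℕ) : ℂ) ^ (-s)) {δ : ℝ}
    (hδ : 0 < δ) (hmaps : MapsTo φ (halfPlane 0) (halfPlane δ)) : PowersTendToZero φ := by
  have hbd : ∀ t : ℝ, δ ≤ (∑' n, c n * ((n : ℕ) : ℂ) ^ (-(t * Complex.I))).re :=
    le_re_tsum_mul_cpow_neg_mul_I (c₀ := c₀) hc fun s hs => by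
      rw [← hφ s hs]
      exact hmaps hs
  -- Ensures that the identity operator has norm `1`.
  have : Nontrivial WD := ⟨WD.basis 1, 0, fun h => by
    simpa [h] using WD.norm_basis 1⟩
  let P : ℝ → WD →L[ℂ] WD := fun t => NormedSpace.exp (-(t : ℂ) • ∑' n, c n • WD.shift n)
  have hP : Tendsto (fun t => ‖P t‖) atTop (𝓝 0) :=
    tendsto_norm_exp_neg_smul_tsum WD.shift WD.norm_shift_le hc hδ hbd
  refine ⟨fun n => WD.shift (n ^ c₀) (P (Real.log (n : ℕ)) (WD.basis 1)), ?_, ?_⟩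
  · intro n s hs
    have hs' : 0 ≤ s.re := le_of_lt hs
    have hexp : (WD.evalCLM s hs').comp (P (Real.log (n : ℕ))) =
        Complex.exp (-(Real.log (n : ℕ) : ℂ) * ∑' n, c n * ((n : ℕ) : ℂ) ^ (-s)) •
          WD.evalCLM s hs' := by
      refine comp_exp_of_comp_eq_smul ?_
      rw [ContinuousLinearMap.comp_smul, WD.evalCLM_comp_tsum_shift hs' hc, smul_smul]
    have h1 := DFunLike.congr_fun (WD.evalCLM_comp_shift hs' (n ^ c₀))
      (P (Real.log (n : ℕ)) (WD.basis 1))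
    have h2 := DFunLike.congr_fun hexp (WD.basis 1)
    simp only [ContinuousLinearMap.comp_apply, smul_apply, smul_eq_mul] at h1 h2
    rw [h2, WD.evalCLM_apply, WD.evalCLM_apply, WD.eval_basis _ hs'] at h1
    have hn : ((n : ℕ) : ℂ) ≠ 0 := Nat.cast_ne_zero.2 n.ne_zero
    simp only [h1, hφ s hs]
    rw [PNat.pow_coe, Nat.cast_pow, PNat.one_coe, Nat.cast_one,
      Complex.one_cpow, mul_one, Complex.cpow_def_of_ne_zero hn,
      Complex.cpow_def_of_ne_zero (pow_ne_zero _ hn), ← Complex.exp_add, ← Nat.cast_pow,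
      ← Complex.natCast_log, ← Complex.natCast_log, Nat.cast_pow, Real.log_pow]
    congr 1
    push_cast
    ring
  · have hlog : Tendsto (fun n : ℕ+ => Real.log (n : ℕ)) atTop atTop :=
      Real.tendsto_log_atTop.comp (tendsto_natCast_atTop_atTop.comp tendsto_PNat_val_atTop_atTop)
    refine squeeze_zero (fun n => norm_nonneg _) (fun n => ?_) (hP.comp hlog)
    refine ((WD.shift (n ^ c₀)).le_of_opNorm_le (WD.norm_shift_le _) _).trans ?_
    rw [one_mul]
    simpa [WD.norm_basis] using (P (Real.log (n : ℕ))).le_opNorm (WD.basis 1)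

end WienerDirichlet

end

open WienerDirichlet in
theorem theorem2p2 (c₀ : ℕ) (φ ϕ : ℂ → ℂ) (hϕ : IsConvergentDirichletSeries ϕ)
    (hφ : ∀ s ∈ halfPlane 0, φ s = (c₀ : ℂ) * s + ϕ s)
    (hnc : ¬ ∃ w : ℂ, ∀ s ∈ halfPlane 0, φ s = w) :
    (CompMapsInto φ → PowersBounded φ) ∧
    (PowersBounded φ → Set.MapsTo φ (halfPlane 0) (halfPlane 0) ∧ CompBounded φ) ∧
    (CompCompact φ ↔ PowersTendToZero φ) ∧
    (CompCompact φ → ∃ δ : ℝ, 0 < δ ∧ Set.MapsTo φ (halfPlane 0) (halfPlane δ)) ∧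
    (∀ c : ℕ+ → ℂ, HasDirichletExpansion ϕ c → Summable (fun n => ‖c n‖) →
      (CompCompact φ ↔ ∃ δ : ℝ, 0 < δ ∧ Set.MapsTo φ (halfPlane 0) (halfPlane δ))) := by
  have hd : DifferentiableOn ℂ φ (halfPlane 0) :=
    (((differentiable_id.const_mul (c₀ : ℂ)).differentiableOn).add hϕ.1).congr hφ
  -- Non-constancy is essential: for a constant purely imaginary `φ` the operator has rank one, yet
  -- `‖n^{-φ}‖ = 1`.
  have hzero : CompCompact φ → PowersTendToZero φ := fun h =>
    h.powersTendToZero (h.compBounded.powersBounded.mapsTo hd hnc)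
  refine ⟨fun h => h.compBounded.powersBounded, fun h => ⟨h.mapsTo hd hnc, h.compBounded⟩,
    ⟨hzero, fun h => h.compCompact⟩, fun h => (hzero h).exists_mapsTo,
    fun c hexp hc => ⟨fun h => (hzero h).exists_mapsTo, ?_⟩⟩
  rintro ⟨δ, hδ, hmaps⟩
  refine PowersTendToZero.compCompact (powersTendToZero_of_mapsTo (c₀ := c₀) hc ?_ hδ hmaps)
  intro s hs
  rw [hφ s hs, hexp.eqOn_tsum hϕ.1 hc hs]
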